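/- Let $\mathbf{Met}$ be the symmetric monoidal closed category of extended metric spaces (distance $\infty$ allowed) and nonexpanding maps, with the addition metric on tensor products. A metric-enriched category $\mathcal K$ is a category whose hom-sets carry extended metrics such that composition is nonexpanding for the addition metric; weighted (and in particular conical) colimits are understood in the enriched sense. A morphism $m\colon P\to X$ is an *isometric embedding* if $d(u_1,u_2)=d(m u_1,m u_2)$ for all parallel pairs $u_1,u_2\colon U\to P$. Let $\mathcal B$ be the category obtained from the chain of all real numbers $\varepsilon\ge 0$ by adding an object $a$ and two cocones $l_\varepsilon,r_\varepsilon\colon\varepsilon\to a$, discretely enriched. The basic weight $B\colon\mathcal B^{\mathrm{op}}\to\mathbf{Met}$ has $Ba=\{*\}$, $B\varepsilon=\{0,1\}$ with $d(0,1)=\varepsilon$ (a single point for $\varepsilon=0$), $Bl_\varepsilon(*)=0$, $Br_\varepsilon(*)=1$, and identity-carried maps $B(\varepsilon\to\varepsilon')$. The *colimit map* of a diagram $D\colon\mathcal B\to\mathcal K$ is the morphism $f=u_a(*)\colon Da\to C$, where $u$ is the unit of the weighted colimit $C=\operatorname{colim}_B D$. A *subregular epimorphism* is a morphism that is the colimit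 map of some $D\colon\mathcal B\to\mathcal K$. The *$\varepsilon$-kernel pair* of $f\colon X\to Y$ is a pair $p,p'\colon P\to X$ with $d(fp,fp')\le\varepsilon$, isometric in the sense that $d(u_1,u_2)=\max\{d(pu_1,pu_2),d(p'u_1,p'u_2)\}$ for all parallel pairs $u_1,u_2\colon U\to P$, and such that every pair $q,q'\colon Q\to X$ with $d(fq,fq')\le\varepsilon$ factorizes through $(p,p')$. The *kernel diagram* of $f$ is the diagram $D\colon\mathcal B\to\mathcal K$ with $Da=X$ for which $(Dl_\varepsilon,Dr_\varepsilon)$ is the $\varepsilon$-kernel pair of $f$ for every $\varepsilon\ge0$. An object $G$ of $\mathcal K$ is a *subvarietal generator* if (i) $G$ has tensors: $M\otimes G$ exists for every $M\in\mathbf{Met}$, with isomorphisms $\mathcal K(M\otimes G,X)\cong\mathbf{Met}(M,\mathcal K(G,X))$ in $\mathbf{Met}$, natural in $X$; (ii) for every object $K$ the evaluation morphism $\mathcal K(G,K)\otimes G\to K$ is a subregular epimorphism; (iii) $G$ is abstractly finite: every morphism from $G$ to a copower $\coprod_M G$ factorizes through $\coprod_{M'}G$ for some finite $M'\subseteq M$;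 and (iv) $G$ is a subregular projective: every morphism from $G$ to $Y$ factorizes through each subregular epimorphism $X\to Y$. **Proposition.** Let $\mathcal K$ be a metric-enriched category with (conical) coequalizers of reflexive pairs and a subvarietal generator. Then $\mathcal K$ has the factorization system $(\mathcal E,\mathcal M)$ with $\mathcal E$ the subregular epimorphisms and $\mathcal M$ the isometric embeddings: both classes contain all isomorphisms and are closed under composition; every morphism $f$ has a factorization $f=m\cdot e$ with $e\in\mathcal E$ and $m\in\mathcal M$; and for every commutative square $m\cdot p=q\cdot e$ with $e\in\mathcal E$ and $m\in\mathcal M$ there is a unique $d$ with $d\cdot e=p$ and $m\cdot d=q$. Moreover, every morphism $f\colon X\to Y$ has a kernel diagram $D$, the colimit of $D$ weighted by $B$ exists, and, for every such colimit with colimit map $e\colon X\to Z$, the morphism $e$ is a subregular epimorphism, there is a unique $m\colon Z\to Y$ with $f=m\cdot e$, and this $m$ is an isometric embedding. -/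

import Mathlib

open CategoryTheory Opposite
open scoped NNReal ENNReal

universe w w' v u

namespace MetEnr

/-! ### The category of extended metric spaces and nonexpanding maps -/

/-- An extended metric space: distances are in `[0, ∞]`, and `d(x, y) = 0` only for `x = y`. -/
structure Met : Type (v + 1) where
  carrier : Type v
  [str : EMetricSpace carrier]

instance : CoeSort Met.{v} (Type v) := ⟨Met.carrier⟩

instance (M : Met.{v}) : EMetricSpace M := M.str

/-- Morphisms of `Met`: nonexpanding maps. -/
@[ext]
structure Met.Hom (M N : Met.{v}) : Type v where
  toFun : M → N
  nonexpanding : ∀ x y : M, edist (toFun x) (toFun y) ≤ edist x y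

instance : Category.{v} Met.{v} where
  Hom M N := Met.Hom M N
  id _ := ⟨fun x => x, fun _ _ => le_rfl⟩
  comp f g := ⟨fun x => g.toFun (f.toFun x), fun x y =>
    (g.nonexpanding _ _).trans (f.nonexpanding x y)⟩

/-- The function underlying a morphism of `Met`. -/
def Met.fn {M N : Met.{v}} (f : M ⟶ N) : M → N := Met.Hom.toFun f

/-! ### Categories enriched over `Met` -/

/-- A metric-enriched category: every hom-set carries an extended metric, and composition is
nonexpanding with respect to the addition metric. -/
class MetEnriched (C : Type u) [Category.{v} C] where
  [emetric : ∀ X Y : C, EMetricSpace (X ⟶ Y)]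
  edist_comp_le : ∀ {X Y Z : C} (f f' : X ⟶ Y) (g g' : Y ⟶ Z),
    edist (f ≫ g) (f' ≫ g') ≤ edist f f' + edist g g'

attribute [reducible, instance] MetEnriched.emetric

/-- The supremum metric on the hom-sets of `Met`. -/
noncomputable instance Met.homEMetric (M N : Met.{v}) : EMetricSpace (M ⟶ N) where
  edist f g := ⨆ x : M, edist (Met.fn f x) (Met.fn g x)
  edist_self f := by simp
  edist_comm f g := by simp only [edist_comm]
  edist_triangle f g h := iSup_le fun x =>
    (edist_triangle _ (Met.fn g x) _).trans
      (add_le_add (le_iSup (fun x : M => edist (Met.fn f x) (Met.fn g x)) x)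
        (le_iSup (fun x : M => edist (Met.fn g x) (Met.fn h x)) x))
  eq_of_edist_eq_zero {f g} h := Met.Hom.ext <| funext fun x =>
    eq_of_edist_eq_zero (le_antisymm
      ((le_iSup (fun x : M => edist (Met.fn f x) (Met.fn g x)) x).trans h.le) zero_le)

/-- `Met` is enriched over itself. -/
noncomputable instance : MetEnriched Met.{v} where
  edist_comp_le f f' g g' := iSup_le fun x =>
    (edist_triangle _ (Met.fn g (Met.fn f' x)) _).trans
      (add_le_add
        ((Met.Hom.nonexpanding g _ _).trans
          (le_iSup (fun x => edist (Met.fn f x) (Met.fn f' x)) x))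
        (le_iSup (fun y => edist (Met.fn g y) (Met.fn g' y)) (Met.fn f' x)))

section

variable {C : Type u} [Category.{v} C] [MetEnriched C]

/-- The hom-space `C(X, Y)`, an object of `Met`. -/
def homSpace (X Y : C) : Met.{v} := ⟨X ⟶ Y⟩

/-- Precomposition with `f`, as a nonexpanding map of hom-spaces. -/
def precompHom {X X' : C} (f : X' ⟶ X) (Y : C) : homSpace X Y ⟶ homSpace X' Y :=
  Met.Hom.mk (M := homSpace X Y) (N := homSpace X' Y) (fun (g : X ⟶ Y) => f ≫ g)
    (fun (g g' : X ⟶ Y) => 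
      (MetEnriched.edist_comp_le f f g g').trans_eq (by rw [edist_self, zero_add]; rfl))

/-- Postcomposition with `h`, as a nonexpanding map of hom-spaces. -/
def postcompHom (X : C) {Y Y' : C} (h : Y ⟶ Y') : homSpace X Y ⟶ homSpace X Y' :=
  Met.Hom.mk (M := homSpace X Y) (N := homSpace X Y') (fun (g : X ⟶ Y) => g ≫ h)
    (fun (g g' : X ⟶ Y) => 
      (MetEnriched.edist_comp_le g g' h h).trans_eq (by rw [edist_self, add_zero]; rfl))

/-! ### Isometric embeddings, quotients, relations -/

/-- `p` is an isometric embedding: `d(u₁, u₂) = d(p · u₁, p · u₂)` for all parallel `u₁, u₂`. -/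
def IsIsometricEmbedding {P X : C} (p : P ⟶ X) : Prop :=
  ∀ ⦃U : C⦄ (u₁ u₂ : U ⟶ P), edist u₁ u₂ = edist (u₁ ≫ p) (u₂ ≫ p)

/-- `p` is a quotient: `d(u₁, u₂) = d(u₁ · p, u₂ · p)` for all parallel `u₁, u₂`. -/
def IsQuotient {P X : C} (p : P ⟶ X) : Prop :=
  ∀ ⦃U : C⦄ (u₁ u₂ : X ⟶ U), edist u₁ u₂ = edist (p ≫ u₁) (p ≫ u₂)

/-- An isometric parallel pair (a relation on `X`). -/
def IsIsometricPair {P X : C} (p p' : P ⟶ X) : Prop :=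
  ∀ ⦃U : C⦄ (u₁ u₂ : U ⟶ P),
    edist u₁ u₂ = max (edist (u₁ ≫ p) (u₂ ≫ p)) (edist (u₁ ≫ p') (u₂ ≫ p'))

/-- `(p, p')` is the `ε`-kernel pair of `f`: the universal pair with `d(f · p, f · p') ≤ ε`. -/
structure IsEpsKernelPair (ε : ℝ≥0) {P X Y : C} (f : X ⟶ Y) (p p' : P ⟶ X) : Prop where
  isometric : IsIsometricPair p p'
  edist_le : edist (p ≫ f) (p' ≫ f) ≤ (ε : ℝ≥0∞)
  factors : ∀ ⦃Q : C⦄ (q q' : Q ⟶ X), edist (q ≫ f) (q' ≫ f) ≤ (ε : ℝ≥0∞) →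
    ∃ t : Q ⟶ P, t ≫ p = q ∧ t ≫ p' = q'

/-! ### Weighted colimits -/

variable {J : Type w} [Category.{w'} J]

/-- The functor `C(D -, X) : Jᵒᵖ ⥤ Met`. -/
def homFunctor (D : J ⥤ C) (X : C) : Jᵒᵖ ⥤ Met.{v} where
  obj j := homSpace (D.obj j.unop) X
  map f := precompHom (D.map f.unop) X
  map_id j := by
    apply Met.Hom.ext; funext (g : D.obj j.unop ⟶ X)
    change D.map (𝟙 j.unop) ≫ g = g
    simp
  map_comp {i j k} f f' := by
    apply Met.Hom.ext; funext (g : D.obj i.unop ⟶ X)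
    change D.map (f'.unop ≫ f.unop) ≫ g = D.map f'.unop ≫ D.map f.unop ≫ g
    simp

/-- The natural transformation `C(D -, h) : C(D -, X) ⟶ C(D -, Y)`. -/
def homFunctorMap (D : J ⥤ C) {X Y : C} (h : X ⟶ Y) : homFunctor D X ⟶ homFunctor D Y where
  app j := postcompHom (D.obj j.unop) h
  naturality i j f := by
    apply Met.Hom.ext; funext (g : D.obj i.unop ⟶ X)
    change (D.map f.unop ≫ g) ≫ h = D.map f.unop ≫ g ≫ h
    simp

/-- `Z` is the colimit of `D` weighted by `W`, with unit `u : W ⟶ C(D -, Z)`. That is, the maps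
`C(Z, X) → [Jᵒᵖ, Met](W, C(D -, X))`, `h ↦ C(D -, h) · u`, are isomorphisms in `Met` (bijective
isometries), where the distance of natural transformations is the supremum of the distances of
their components. The shape `J` is understood to be discretely enriched (distinct morphisms have
distance `∞`), so that every functor on it is an enriched functor. -/
structure IsWeightedColimit (W : Jᵒᵖ ⥤ Met.{v}) (D : J ⥤ C) (Z : C)
    (u : W ⟶ homFunctor D Z) : Prop where
  bijective : ∀ X : C, Function.Bijective (fun h : Z ⟶ X => u ≫ homFunctorMap D h)
  isometry : ∀ (X : C) (h h' : Z ⟶ X),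
    edist h h' = ⨆ j : Jᵒᵖ, edist ((u ≫ homFunctorMap D h).app j) ((u ≫ homFunctorMap D h').app j)

end

/-! ### The basic shape and the basic weight -/

/-- Objects of the basic shape: the real numbers `ε ≥ 0` and one further object `a`. -/
inductive BasicShape : Type
  | num (ε : ℝ≥0) : BasicShape
  | a : BasicShape

/-- The two cocones `l`, `r`. -/
inductive Side : Type
  | l : Side
  | r : Side

/-- Morphisms of the basic shape: one `ε ⟶ ε'` for `ε ≤ ε'`, two morphisms `l_ε, r_ε : ε ⟶ a`,
and the identity of `a`. -/
def BasicShape.Hom : BasicShape → BasicShape → Type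
  | .num ε, .num ε' => PLift (ε ≤ ε')
  | .num _, .a => Side
  | .a, .a => PUnit
  | .a, .num _ => PEmpty

/-- Identities of the basic shape. -/
def BasicShape.id : ∀ i : BasicShape, BasicShape.Hom i i
  | .num _ => PLift.up le_rfl
  | .a => PUnit.unit

/-- Composition in the basic shape: both cocones are compatible with the chain. -/
def BasicShape.comp : ∀ {i j k : BasicShape},
    BasicShape.Hom i j → BasicShape.Hom j k → BasicShape.Hom i k
  | .num _, .num _, .num _, f, g => PLift.up (f.down.trans g.down)
  | .num _, .num _, .a, _, s => s
  | .num _, .a, .a, s, _ => s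
  | .a, .a, .a, _, _ => PUnit.unit
  | .a, .num _, _, f, _ => f.elim
  | .num _, .a, .num _, _, g => g.elim
  | .a, .a, .num _, _, g => g.elim

instance : Category.{0} BasicShape where
  Hom := BasicShape.Hom
  id := BasicShape.id
  comp := BasicShape.comp
  id_comp {i j} f := by cases i <;> cases j <;> first | rfl | exact f.elim
  comp_id {i j} f := by cases i <;> cases j <;> first | rfl | exact f.elim
  assoc {i j k l} f g h := by
    cases i <;> cases j <;> cases k <;> cases l <;>
      first | rfl | exact PEmpty.elim f | exact PEmpty.elim g | exact PEmpty.elim h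

/-- The morphism `ε ⟶ ε'` of the chain. -/
def BasicShape.step {ε ε' : ℝ≥0} (h : ε ≤ ε') : BasicShape.num ε ⟶ BasicShape.num ε' :=
  (PLift.up h : PLift (ε ≤ ε'))

/-- `l_ε : ε ⟶ a`. -/
def BasicShape.left (ε : ℝ≥0) : BasicShape.num ε ⟶ BasicShape.a := (Side.l : Side)

/-- `r_ε : ε ⟶ a`. -/
def BasicShape.right (ε : ℝ≥0) : BasicShape.num ε ⟶ BasicShape.a := (Side.r : Side)

/-- The space `{0, ε}` with `d(0, ε) = ε`, that is, the two-point space with distance `ε` (for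
`ε = 0` the two points coincide). -/
noncomputable def twoPoint (ε : ℝ≥0) : Met.{v} :=
  ⟨ULift.{v} {x : ℝ≥0 // x = 0 ∨ x = ε}⟩

/-- The one-point space. -/
noncomputable def onePoint : Met.{v} := ⟨PUnit.{v + 1}⟩

/-- The point of `twoPoint ε` on the given side: `0` on the left, `ε` on the right. -/
def twoPoint.pt (ε : ℝ≥0) : Side → twoPoint.{v} ε
  | .l => ULift.up ⟨0, Or.inl rfl⟩
  | .r => ULift.up ⟨ε, Or.inr rfl⟩

/-- The identity-like map `twoPoint ε' ⟶ twoPoint ε` for `ε ≤ ε'`: `0 ↦ 0` and `ε' ↦ ε`. -/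
noncomputable def twoPoint.shrink {ε ε' : ℝ≥0} (h : ε ≤ ε') : twoPoint.{v} ε' ⟶ twoPoint.{v} ε :=
  Met.Hom.mk (M := twoPoint.{v} ε') (N := twoPoint.{v} ε)
    (fun (x : ULift.{v} {x : ℝ≥0 // x = 0 ∨ x = ε'}) => ULift.up ⟨min x.down.1 ε, by
      rcases x.down.2 with hx | hx
      · left; rw [hx]; exact min_eq_left zero_le
      · right; rw [hx]; exact min_eq_right h⟩)
    (fun (x y : ULift.{v} {x : ℝ≥0 // x = 0 ∨ x = ε'}) => by
      change edist (min x.down.1 ε) (min y.down.1 ε) ≤ edist x.down.1 y.down.1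
      rw [edist_nndist, edist_nndist, ENNReal.coe_le_coe, ← NNReal.coe_le_coe, coe_nndist,
        coe_nndist, NNReal.dist_eq, NNReal.dist_eq, NNReal.coe_min, NNReal.coe_min]
      simpa using abs_min_sub_min_le_max (x.down.1 : ℝ) ε y.down.1 ε)

/-- The map `onePoint ⟶ M` with the given value. -/
def Met.point {M : Met.{v}} (x : M) : onePoint.{v} ⟶ M :=
  Met.Hom.mk (M := onePoint.{v}) (N := M) (fun _ => x) (fun _ _ => by simp)

/-- The basic weight on objects: `B ε = {0, ε}` and `B a` is a point. -/
noncomputable def basicWeightObj : BasicShape → Met.{v}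
  | .num ε => twoPoint ε
  | .a => onePoint

/-- The basic weight on morphisms: `B l_ε` and `B r_ε` are the two points of `B ε`. -/
noncomputable def basicWeightMap : ∀ {i j : BasicShape}, BasicShape.Hom i j →
    (basicWeightObj.{v} j ⟶ basicWeightObj.{v} i)
  | .num _, .num _, f => twoPoint.shrink f.down
  | .num ε, .a, s => Met.point (M := twoPoint.{v} ε) (twoPoint.pt ε s)
  | .a, .a, _ => 𝟙 _
  | .a, .num _, f => f.elim

/-- The basic weight `B : BasicShapeᵒᵖ ⥤ Met`. -/
noncomputable def basicWeight : BasicShapeᵒᵖ ⥤ Met.{v} where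
  obj i := basicWeightObj i.unop
  map f := basicWeightMap f.unop
  map_id i := by
    obtain ⟨i⟩ := i
    cases i with
    | num ε =>
      apply Met.Hom.ext; funext (x : ULift.{v} {x : ℝ≥0 // x = 0 ∨ x = ε})
      apply ULift.ext; apply Subtype.ext
      change min x.down.1 ε = x.down.1
      rcases x.down.2 with hx | hx <;> simp [hx]
    | a => rfl
  map_comp {i j k} f g := by
    obtain ⟨i⟩ := i; obtain ⟨j⟩ := j; obtain ⟨k⟩ := k
    obtain ⟨f⟩ := f; obtain ⟨g⟩ := g
    cases k with
    | a =>
      cases j with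
      | num _ => exact PEmpty.elim g
      | a =>
        cases i with
        | num _ => exact PEmpty.elim f
        | a => rfl
    | num ε₃ =>
      cases j with
      | num ε₂ =>
        cases i with
        | num ε₁ =>
          apply Met.Hom.ext; funext (x : ULift.{v} {x : ℝ≥0 // x = 0 ∨ x = ε₁})
          apply ULift.ext; apply Subtype.ext
          change min x.down.1 ε₃ = min (min x.down.1 ε₂) ε₃
          have h : ε₃ ≤ ε₂ := PLift.down g
          rw [min_assoc, min_eq_right h]
        | a =>
          have h : ε₃ ≤ ε₂ := PLift.down g
          change Side at f
          cases f with
          | l =>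
            apply Met.Hom.ext; funext _
            apply ULift.ext; apply Subtype.ext
            change (0 : ℝ≥0) = min 0 ε₃
            simp
          | r =>
            apply Met.Hom.ext; funext _
            apply ULift.ext; apply Subtype.ext
            change ε₃ = min ε₂ ε₃
            rw [min_eq_right h]
      | a =>
        cases i with
        | num _ => exact PEmpty.elim f
        | a => rfl

section

variable {C : Type u} [Category.{v} C] [MetEnriched C]

/-! ### Basic colimits, subregular epimorphisms, kernel diagrams -/

/-- `f : D a ⟶ Z` is the colimit map of the basic diagram `D`: it is the morphism `u_a(∗)` for the
unit `u` of a colimit `Z` of `D` weighted by the basic weight. -/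
def IsColimitMap (D : BasicShape ⥤ C) {Z : C} (f : D.obj .a ⟶ Z) : Prop :=
  ∃ u : basicWeight.{v} ⟶ homFunctor D Z,
    IsWeightedColimit basicWeight D Z u ∧ Met.fn (u.app (op .a)) PUnit.unit = f

/-- A subregular epimorphism: the colimit map of some basic diagram. -/
def IsSubregularEpi {X Y : C} (e : X ⟶ Y) : Prop :=
  ∃ (D : BasicShape ⥤ C) (h : D.obj .a = X), IsColimitMap D (eqToHom h ≫ e)

/-- `D` is the kernel diagram of `f`: the pair `D l_ε, D r_ε` is the `ε`-kernel pair of `f` for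
every `ε`. (The morphisms `D(ε ⟶ ε')` are then the unique factorizations.) -/
def IsKernelDiagram (D : BasicShape ⥤ C) {Y : C} (f : D.obj .a ⟶ Y) : Prop :=
  ∀ ε : ℝ≥0, IsEpsKernelPair ε f (D.map (BasicShape.left ε)) (D.map (BasicShape.right ε))

/-! ### Reflexive coequalizers -/

/-- `q` is the (conical) coequalizer of `f, g`: precomposition with `q` is an isometric bijection
from `C(Q, Z)` onto the space of all `h : Y ⟶ Z` with `h · f = h · g`. -/
structure IsConicalCoequalizer {X Y Q : C} (f g : X ⟶ Y) (q : Y ⟶ Q) : Prop where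
  condition : f ≫ q = g ≫ q
  isQuotient : IsQuotient q
  factors : ∀ ⦃Z : C⦄ (h : Y ⟶ Z), f ≫ h = g ≫ h → ∃! k : Q ⟶ Z, q ≫ k = h

variable (C) in
/-- `C` has (conical) coequalizers of reflexive pairs, i.e. of parallel pairs of split
epimorphisms with a common splitting. -/
def HasReflexiveConicalCoequalizers : Prop :=
  ∀ ⦃X Y : C⦄ (f g : X ⟶ Y), IsReflexivePair f g →
    ∃ (Q : C) (q : Y ⟶ Q), IsConicalCoequalizer f g q

/-! ### Tensors, copowers, generators -/

/-- `T` is the tensor `M ⊗ K` with unit `η : M ⟶ C(K, T)`: the maps `C(T, X) → Met(M, C(K, X))`,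
`h ↦ C(K, h) · η`, are isomorphisms in `Met` (bijective isometries). -/
structure IsTensor (M : Met.{v}) (K T : C) (η : M ⟶ homSpace K T) : Prop where
  bijective : ∀ X : C, Function.Bijective (fun h : T ⟶ X => η ≫ postcompHom K h)
  isometry : ∀ (X : C) (h h' : T ⟶ X),
    edist h h' = edist (η ≫ postcompHom K h) (η ≫ postcompHom K h')

/-- `K` has tensors: `M ⊗ K` exists for all spaces `M`. -/
def HasTensors (K : C) : Prop :=
  ∀ M : Met.{v}, ∃ (T : C) (η : M ⟶ homSpace K T), IsTensor M K T η

/-- `T` with the injections `ι` is the (conical) copower of `M` copies of `K`. -/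
structure IsCopower (M : Type v) (K T : C) (ι : M → (K ⟶ T)) : Prop where
  factors : ∀ ⦃X : C⦄ (φ : M → (K ⟶ X)), ∃! h : T ⟶ X, ∀ m, ι m ≫ h = φ m
  isometry : ∀ ⦃X : C⦄ (h h' : T ⟶ X), edist h h' = ⨆ m, edist (ι m ≫ h) (ι m ≫ h')

/-- `K` is abstractly finite: every morphism from `K` to a copower `∐_M K` factorizes through a
finite subcopower `∐_{M'} K`, `M' ⊆ M` finite. -/
def IsAbstractlyFinite (K : C) : Prop :=
  ∀ ⦃M : Type v⦄ ⦃T : C⦄ (ι : M → (K ⟶ T)), IsCopower M K T ι → ∀ f : K ⟶ T,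
    ∃ (M' : Set M) (S : C) (κ : M' → (K ⟶ S)) (j : S ⟶ T) (g : K ⟶ S),
      M'.Finite ∧ IsCopower M' K S κ ∧ (∀ m : M', κ m ≫ j = ι m) ∧ g ≫ j = f

/-- `K` is a subregular projective: every morphism from `K` to `Y` factorizes through each
subregular epimorphism `X ⟶ Y`. -/
def IsSubregularProjective (K : C) : Prop :=
  ∀ ⦃X Y : C⦄ (e : X ⟶ Y), IsSubregularEpi e → ∀ f : K ⟶ Y, ∃ g : K ⟶ X, g ≫ e = f

/-- `ev : C(G, K) ⊗ G ⟶ K` is the evaluation morphism: it corresponds to the identity of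
`C(G, K)`. -/
def IsEvaluation {G K T : C} (η : homSpace G K ⟶ homSpace G T) (ev : T ⟶ K) : Prop :=
  η ≫ postcompHom G ev = 𝟙 (homSpace G K)

/-- A subregular generator: an object `G` with tensors for which all evaluation morphisms
`C(G, K) ⊗ G ⟶ K` are subregular epimorphisms. -/
structure IsSubregularGenerator (G : C) : Prop where
  hasTensors : HasTensors G
  evaluation : ∀ ⦃K T : C⦄ (η : homSpace G K ⟶ homSpace G T), IsTensor (homSpace G K) G T η →
    ∀ ev : T ⟶ K, IsEvaluation η ev → IsSubregularEpi ev

/-- A subvarietal generator: an abstractly finite, subregularly projective subregular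
generator. -/
structure IsSubvarietalGenerator (G : C) : Prop extends IsSubregularGenerator G where
  abstractlyFinite : IsAbstractlyFinite G
  projective : IsSubregularProjective G

/-! ### Factorization systems -/

/-- An (orthogonal) factorization system: both classes contain the isomorphisms and are closed
under composition, every morphism factorizes, and diagonal fill-ins exist and are unique. -/
structure IsFactorizationSystem {C : Type u} [Category.{v} C] (E M : MorphismProperty C) :
    Prop where
  iso_left : MorphismProperty.isomorphisms C ≤ E
  iso_right : MorphismProperty.isomorphisms C ≤ M
  comp_left : ∀ ⦃X Y Z : C⦄ (f : X ⟶ Y) (g : Y ⟶ Z), E f → E g → E (f ≫ g)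
  comp_right : ∀ ⦃X Y Z : C⦄ (f : X ⟶ Y) (g : Y ⟶ Z), M f → M g → M (f ≫ g)
  factorization : ∀ ⦃X Y : C⦄ (f : X ⟶ Y),
    ∃ (Z : C) (e : X ⟶ Z) (m : Z ⟶ Y), E e ∧ M m ∧ e ≫ m = f
  diagonal : ∀ ⦃X Y A B : C⦄ (e : X ⟶ Y) (m : A ⟶ B) (p : X ⟶ A) (q : Y ⟶ B), E e → M m →
    p ≫ m = e ≫ q → ∃! d : Y ⟶ A, e ≫ d = p ∧ d ≫ m = q

variable (C)

/-- The class of subregular epimorphisms. -/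
def subregularEpis : MorphismProperty C := fun _ _ e => IsSubregularEpi e

/-- The class of isometric embeddings. -/
def isometricEmbeddings : MorphismProperty C := fun _ _ m => IsIsometricEmbedding m

end

end MetEnr

open MetEnr

/-!
Write `U X = C(G, X)` and `F M = M ⊗ G`. The cocones of the kernel diagram of `f` are the morphisms
dominated by `f`, that is, those that bring parallel morphisms at least as close together as `f`
does. Hence subregular epimorphisms are the quotients `e` through which every morphism dominated by
`e` factorizes, which gives the diagonal fill-ins.

A coequalizer is the colimit map of a basic diagram that is constant on the chain, so the projective
object `G` sees reflexive coequalizers as surjections. Therefore every subspace `M` of a product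
`∏ U (X i)` that is closed under the operations `t : G ⟶ F M` has the form `U Q` for a jointly
isometric family `Q ⟶ X i`, where `Q` is the coequalizer of a reflexive pair `F U F M ⇉ F M`. The
pairs of points of `X` whose images under `f` have distance at most `ε` yield the `ε`-kernel pair
of `f`, and the points of `Y` of the form `f · x` yield its image.
-/

namespace MetEnr

section Isometries

variable {C : Type u} [Category.{v} C] [MetEnriched C]

theorem edist_comp_left_le {X Y Z : C} (f : X ⟶ Y) (g g' : Y ⟶ Z) :
    edist (f ≫ g) (f ≫ g') ≤ edist g g' := by
  simpa only [edist_self, zero_add] using MetEnriched.edist_comp_le f f g g'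

theorem edist_comp_right_le {X Y Z : C} (f f' : X ⟶ Y) (g : Y ⟶ Z) :
    edist (f ≫ g) (f' ≫ g) ≤ edist f f' := by
  simpa only [edist_self, add_zero] using MetEnriched.edist_comp_le f f' g g

theorem isQuotient_of_le {X Y : C} {e : X ⟶ Y}
    (he : ∀ ⦃U : C⦄ (u₁ u₂ : Y ⟶ U), edist u₁ u₂ ≤ edist (e ≫ u₁) (e ≫ u₂)) : IsQuotient e :=
  fun _ u₁ u₂ => (he u₁ u₂).antisymm (edist_comp_left_le e u₁ u₂)

theorem IsQuotient.epi {X Y : C} {e : X ⟶ Y} (he : IsQuotient e) : Epi e :=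
  ⟨fun u₁ u₂ h => eq_of_edist_eq_zero (by rw [he, h, edist_self])⟩

theorem isQuotient_of_isIso {X Y : C} (e : X ⟶ Y) [IsIso e] : IsQuotient e :=
  isQuotient_of_le fun _ u₁ u₂ => by
    simpa only [IsIso.inv_hom_id_assoc] using edist_comp_left_le (inv e) (e ≫ u₁) (e ≫ u₂)

theorem IsQuotient.comp {X Y Z : C} {e : X ⟶ Y} {e' : Y ⟶ Z} (he : IsQuotient e)
    (he' : IsQuotient e') : IsQuotient (e ≫ e') := fun _ u₁ u₂ => by
  rw [he' u₁ u₂, he, Category.assoc, Category.assoc]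

theorem IsQuotient.of_comp {X Y Z : C} {a : X ⟶ Y} {e : Y ⟶ Z} (h : IsQuotient (a ≫ e)) :
    IsQuotient e :=
  isQuotient_of_le fun _ u₁ u₂ => by
    rw [h u₁ u₂, Category.assoc, Category.assoc]
    exact edist_comp_left_le a _ _

theorem isIsometricEmbedding_of_isIso {X Y : C} (m : X ⟶ Y) [IsIso m] :
    IsIsometricEmbedding m := fun _ u₁ u₂ => by
  refine le_antisymm ?_ (edist_comp_right_le u₁ u₂ m)
  simpa only [Category.assoc, IsIso.hom_inv_id, Category.comp_id] using
    edist_comp_right_le (u₁ ≫ m) (u₂ ≫ m) (inv m)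

theorem IsIsometricEmbedding.comp {X Y Z : C} {m : X ⟶ Y} {m' : Y ⟶ Z}
    (hm : IsIsometricEmbedding m) (hm' : IsIsometricEmbedding m') :
    IsIsometricEmbedding (m ≫ m') := fun _ u₁ u₂ => by
  rw [hm u₁ u₂, hm', Category.assoc, Category.assoc]

theorem IsIsometricPair.hom_ext {P X U : C} {p p' : P ⟶ X} (hp : IsIsometricPair p p')
    {u₁ u₂ : U ⟶ P} (h : u₁ ≫ p = u₂ ≫ p) (h' : u₁ ≫ p' = u₂ ≫ p') : u₁ = u₂ :=
  eq_of_edist_eq_zero (by rw [hp, h, h', edist_self, edist_self, max_self])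

/-- A jointly isometric family: distances of parallel morphisms into `P` are the suprema of the
distances of their composites with the members. Isometric embeddings and isometric pairs are the
families with one and two members. -/
def IsIsometricFamily {I : Type*} {P : C} {X : I → C} (p : ∀ i, P ⟶ X i) : Prop :=
  ∀ ⦃U : C⦄ (u₁ u₂ : U ⟶ P), edist u₁ u₂ = ⨆ i, edist (u₁ ≫ p i) (u₂ ≫ p i)

theorem isIsometricFamily_of_unique {I : Type*} [Unique I] {P : C} {X : I → C}
    (p : ∀ i, P ⟶ X i) : IsIsometricFamily p ↔ IsIsometricEmbedding (p default) := by
  simp only [IsIsometricFamily, IsIsometricEmbedding, iSup_unique]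

theorem iSup_side {α : Type*} [CompleteLattice α] (f : Side → α) :
    ⨆ s, f s = f .l ⊔ f .r :=
  le_antisymm (iSup_le (by rintro (_ | _); exacts [le_sup_left, le_sup_right]))
    (sup_le (le_iSup f .l) (le_iSup f .r))

theorem isIsometricFamily_side {P : C} {X : C} (p : Side → (P ⟶ X)) :
    IsIsometricFamily p ↔ IsIsometricPair (p .l) (p .r) := by
  simp only [IsIsometricFamily, IsIsometricPair, iSup_side]

end Isometries

section TwoPoint

theorem twoPoint.pt_surjective (ε : ℝ≥0) : Function.Surjective (twoPoint.pt.{v} ε) := by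
  rintro ⟨x, rfl | rfl⟩
  exacts [⟨.l, rfl⟩, ⟨.r, rfl⟩]

theorem twoPoint.edist_pt (ε : ℝ≥0) : edist (twoPoint.pt.{v} ε .l) (twoPoint.pt ε .r) = ε := by
  change edist (0 : ℝ≥0) ε = ε
  rw [edist_nndist, nndist_comm, NNReal.nndist_zero_eq_val']

theorem twoPoint.shrink_pt {ε ε' : ℝ≥0} (h : ε ≤ ε') (s : Side) :
    Met.fn (twoPoint.shrink.{v} h) (twoPoint.pt ε' s) = twoPoint.pt ε s := by
  cases s
  · exact ULift.ext _ _ (Subtype.ext (min_eq_left zero_le))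
  · exact ULift.ext _ _ (Subtype.ext (min_eq_right h))

theorem twoPoint.edist_le_edist_pt {ε : ℝ≥0} {N : Met.{v}} {y : Side → N}
    (hy : edist (y .l) (y .r) ≤ ε) (s t : Side) :
    edist (y s) (y t) ≤ edist (twoPoint.pt.{v} ε s) (twoPoint.pt ε t) := by
  cases s <;> cases t
  · rw [edist_self]; exact zero_le
  · rwa [twoPoint.edist_pt]
  · rwa [edist_comm, edist_comm (twoPoint.pt ε .r), twoPoint.edist_pt]
  · rw [edist_self]; exact zero_le

theorem twoPoint.exists_lift {ε : ℝ≥0} {N : Met.{v}} {y : Side → N}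
    (hy : edist (y .l) (y .r) ≤ ε) :
    ∃ f : twoPoint.{v} ε ⟶ N, ∀ s, Met.fn f (twoPoint.pt ε s) = y s := by
  have hfactors : y.FactorsThrough (twoPoint.pt.{v} ε) := fun s t hst =>
    eq_of_edist_eq_zero <| le_antisymm
      ((edist_le_edist_pt hy s t).trans_eq (by rw [hst, edist_self])) zero_le
  have hextend := hfactors.extend_apply fun _ => y .l
  refine ⟨Met.Hom.mk (Function.extend (twoPoint.pt ε) y fun _ => y .l) fun x x' => ?_, hextend⟩
  obtain ⟨s, rfl⟩ := twoPoint.pt_surjective ε x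
  obtain ⟨t, rfl⟩ := twoPoint.pt_surjective ε x'
  rw [hextend, hextend]
  exact edist_le_edist_pt hy s t

end TwoPoint

section BasicWeight

variable {C : Type u} [Category.{v} C] [MetEnriched C] {D : BasicShape ⥤ C} {Z : C}

/-- The morphism `l_ε` or `r_ε` of the basic shape, according to the side. -/
def BasicShape.side (ε : ℝ≥0) (s : Side) : BasicShape.num ε ⟶ BasicShape.a := s

/-- The morphism `u_a(∗)` that a transformation `u` from the basic weight assigns to the point of
`B a`; it determines `u`. -/
noncomputable def weightLeg (u : basicWeight.{v} ⟶ homFunctor D Z) : D.obj .a ⟶ Z :=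
  Met.fn (u.app (op .a)) PUnit.unit

/-- Compatibility of `h` with the diagram: `d(h · D l_ε, h · D r_ε) ≤ ε` for all `ε`. These are the
cocones of `D` weighted by the basic weight. -/
def IsBasicCocone (D : BasicShape ⥤ C) {Z : C} (h : D.obj .a ⟶ Z) : Prop :=
  ∀ ε : ℝ≥0, edist (D.map (BasicShape.left ε) ≫ h) (D.map (BasicShape.right ε) ≫ h) ≤ ε

theorem app_num_pt (u : basicWeight.{v} ⟶ homFunctor D Z) (ε : ℝ≥0) (s : Side) :
    Met.fn (u.app (op (.num ε))) (twoPoint.pt ε s) =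
      D.map (BasicShape.side ε s) ≫ weightLeg u :=
  congrArg (fun k : onePoint.{v} ⟶ homSpace (D.obj (.num ε)) Z => Met.fn k PUnit.unit)
    (u.naturality (BasicShape.side ε s).op)

theorem weightLeg_injective :
    Function.Injective (weightLeg : (basicWeight.{v} ⟶ homFunctor D Z) → (D.obj .a ⟶ Z)) := by
  intro u u' h
  refine NatTrans.ext (funext fun ⟨i⟩ => Met.Hom.ext (funext fun x => ?_))
  cases i with
  | a => exact h
  | num ε =>
    obtain ⟨s, rfl⟩ := twoPoint.pt_surjective ε x
    exact (app_num_pt u ε s).trans (h ▸ (app_num_pt u' ε s).symm)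

theorem weightLeg_comp_homFunctorMap (u : basicWeight.{v} ⟶ homFunctor D Z) {W : C}
    (k : Z ⟶ W) : weightLeg (u ≫ homFunctorMap D k) = weightLeg u ≫ k := rfl

theorem isBasicCocone_weightLeg (u : basicWeight.{v} ⟶ homFunctor D Z) :
    IsBasicCocone D (weightLeg u) := fun ε =>
  calc edist (D.map (BasicShape.side ε .l) ≫ weightLeg u)
        (D.map (BasicShape.side ε .r) ≫ weightLeg u)
      = edist (Met.fn (u.app (op (.num ε))) (twoPoint.pt ε .l))
        (Met.fn (u.app (op (.num ε))) (twoPoint.pt ε .r)) :=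
      congrArg₂ edist (app_num_pt u ε .l).symm (app_num_pt u ε .r).symm
    _ ≤ edist (twoPoint.pt.{v} ε .l) (twoPoint.pt ε .r) := (u.app _).nonexpanding _ _
    _ = ε := twoPoint.edist_pt.{v} ε

theorem IsBasicCocone.exists_weightLeg_eq {h : D.obj .a ⟶ Z} (hh : IsBasicCocone D h) :
    ∃ u : basicWeight.{v} ⟶ homFunctor D Z, weightLeg u = h := by
  have hlift (ε : ℝ≥0) : ∃ f : twoPoint.{v} ε ⟶ homSpace (D.obj (.num ε)) Z,
      ∀ s, Met.fn f (twoPoint.pt ε s) = D.map (BasicShape.side ε s) ≫ h :=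
    twoPoint.exists_lift (N := homSpace (D.obj (.num ε)) Z)
      (y := fun s => D.map (BasicShape.side ε s) ≫ h) (hh ε)
  choose f hf using hlift
  let app : ∀ i : BasicShape, basicWeightObj.{v} i ⟶ homSpace (D.obj i) Z
    | .a => Met.point (M := homSpace (D.obj .a) Z) h
    | .num ε => f ε
  refine ⟨{ app := fun i => app i.unop, naturality := ?_ }, rfl⟩
  rintro ⟨i⟩ ⟨j⟩ ⟨k⟩
  refine Met.Hom.ext (funext fun x => ?_)
  cases i with
  | a =>
    cases j with
    | a => exact ((congrArg (· ≫ h) (D.map_id _)).trans (Category.id_comp h)).symm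
    | num ε => exact hf ε k
  | num ε' =>
    cases j with
    | a => exact PEmpty.elim k
    | num ε =>
      obtain ⟨s, rfl⟩ := twoPoint.pt_surjective ε' x
      have hside : D.map (BasicShape.side ε s) ≫ h = D.map k ≫ D.map (BasicShape.side ε' s) ≫ h :=
        (congrArg (· ≫ h) (D.map_comp k (BasicShape.side ε' s))).trans (Category.assoc _ _ _)
      exact (congrArg (Met.fn (f ε)) (twoPoint.shrink_pt (PLift.down k) s)).trans
        ((hf ε s).trans (hside.trans (congrArg (D.map k ≫ ·) (hf ε' s).symm)))

theorem iSup_edist_app (u u' : basicWeight.{v} ⟶ homFunctor D Z) :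
    ⨆ j : BasicShapeᵒᵖ, edist (u.app j) (u'.app j) = edist (weightLeg u) (weightLeg u') := by
  apply le_antisymm
  · refine iSup_le fun ⟨j⟩ => iSup_le fun x => ?_
    cases j with
    | a => exact le_rfl
    | num ε =>
      obtain ⟨s, rfl⟩ := twoPoint.pt_surjective ε x
      exact (congrArg₂ edist (app_num_pt u ε s) (app_num_pt u' ε s)).trans_le
        (edist_comp_left_le (D.map (BasicShape.side ε s)) _ _)
  · exact le_iSup_of_le (op .a) (le_iSup (fun x : onePoint.{v} =>
      edist (Met.fn (u.app (op .a)) x) (Met.fn (u'.app (op .a)) x)) PUnit.unit)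

theorem isColimitMap_iff (f : D.obj .a ⟶ Z) : IsColimitMap D f ↔
    IsBasicCocone D f ∧ IsQuotient f ∧
      ∀ ⦃W : C⦄ (h : D.obj .a ⟶ W), IsBasicCocone D h → ∃ k : Z ⟶ W, f ≫ k = h := by
  have hedist (u : basicWeight.{v} ⟶ homFunctor D Z) {W : C} (k k' : Z ⟶ W) :=
    iSup_edist_app (u ≫ homFunctorMap D k) (u ≫ homFunctorMap D k')
  simp only [weightLeg_comp_homFunctorMap] at hedist
  constructor
  · rintro ⟨u, hu, rfl⟩
    refine ⟨isBasicCocone_weightLeg u,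
      fun W k k' => (hu.isometry W k k').trans (hedist u k k'), fun W h hh => ?_⟩
    obtain ⟨t, rfl⟩ := hh.exists_weightLeg_eq
    obtain ⟨k, rfl⟩ := (hu.bijective W).surjective t
    exact ⟨k, rfl⟩
  · rintro ⟨hcocone, hquotient, hfactors⟩
    obtain ⟨u, rfl⟩ := hcocone.exists_weightLeg_eq
    have := hquotient.epi
    refine ⟨u, ⟨fun W => ⟨fun k k' h => ?_, fun t => ?_⟩, fun W k k' => ?_⟩, rfl⟩
    · exact (cancel_epi (weightLeg u)).1 (congrArg weightLeg h)
    · obtain ⟨k, hk⟩ := hfactors _ (isBasicCocone_weightLeg t)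
      exact ⟨k, weightLeg_injective hk⟩
    · exact (hquotient k k').trans (hedist u k k').symm

theorem IsColimitMap.isSubregularEpi {e : D.obj .a ⟶ Z} (he : IsColimitMap D e) :
    IsSubregularEpi e :=
  ⟨D, rfl, by rwa [eqToHom_refl, Category.id_comp]⟩

end BasicWeight

section BasicDiagram

variable {C : Type u} [Category.{v} C]

/-- The objects of `basicDiagram`. -/
def basicDiagramObj (F : ℝ≥0 ⥤ C) (X : C) : BasicShape → C
  | .num ε => F.obj ε
  | .a => X

/-- The morphisms of `basicDiagram`. -/
def basicDiagramMap (F : ℝ≥0 ⥤ C) {X : C} (p : Side → (F ⟶ (Functor.const ℝ≥0).obj X)) :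
    ∀ {i j : BasicShape}, BasicShape.Hom i j → (basicDiagramObj F X i ⟶ basicDiagramObj F X j)
  | .num _, .num _, f => F.map (homOfLE f.down)
  | .num ε, .a, s => (p s).app ε
  | .a, .a, _ => 𝟙 X
  | .a, .num _, f => f.elim

/-- The basic diagram given by a chain `F` indexed by the reals `ε ≥ 0`, an object `X` and two
cocones `p .l`, `p .r` from `F` to `X`. -/
def basicDiagram (F : ℝ≥0 ⥤ C) {X : C} (p : Side → (F ⟶ (Functor.const ℝ≥0).obj X)) :
    BasicShape ⥤ C where
  obj := basicDiagramObj F X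
  map f := basicDiagramMap F p f
  map_id
    | .num ε => F.map_id ε
    | .a => rfl
  map_comp {i j k} f g := by
    cases i with
    | a =>
      cases j with
      | num _ => exact PEmpty.elim f
      | a =>
        cases k with
        | num _ => exact PEmpty.elim g
        | a => exact (Category.id_comp (𝟙 X)).symm
    | num ε =>
      cases j with
      | a =>
        cases k with
        | num _ => exact PEmpty.elim g
        | a => exact (Category.comp_id ((p f).app ε)).symm
      | num ε' =>
        cases k with
        | num ε'' => exact F.map_comp (homOfLE (PLift.down f)) (homOfLE (PLift.down g))
        | a =>
          exact ((Category.comp_id _).symm.trans ((p g).naturality (homOfLE (PLift.down f))).symm)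

end BasicDiagram

section Coequalizers

variable {C : Type u} [Category.{v} C] [MetEnriched C]

/-- The basic diagram that is constant at `P` on the chain, with all `l_ε` sent to `f` and all `r_ε`
sent to `g`. -/
def constBasicDiagram {P X : C} (f g : P ⟶ X) : BasicShape ⥤ C :=
  basicDiagram ((Functor.const ℝ≥0).obj P) fun
    | .l => (Functor.const ℝ≥0).map f
    | .r => (Functor.const ℝ≥0).map g

theorem isBasicCocone_constBasicDiagram {P X W : C} {f g : P ⟶ X} {h : X ⟶ W} :
    IsBasicCocone (constBasicDiagram f g) h ↔ f ≫ h = g ≫ h := by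
  change (∀ ε : ℝ≥0, edist (f ≫ h) (g ≫ h) ≤ ε) ↔ _
  refine ⟨fun H => eq_of_edist_eq_zero (le_antisymm (H 0) zero_le), fun H ε => ?_⟩
  rw [H, edist_self]
  exact zero_le

theorem IsConicalCoequalizer.isSubregularEpi {P X Q : C} {f g : P ⟶ X} {q : X ⟶ Q}
    (hq : IsConicalCoequalizer f g q) : IsSubregularEpi q := by
  refine IsColimitMap.isSubregularEpi (D := constBasicDiagram f g) ((isColimitMap_iff q).2
    ⟨isBasicCocone_constBasicDiagram.2 hq.condition, hq.isQuotient, fun W h hh => ?_⟩)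
  exact (hq.factors h (isBasicCocone_constBasicDiagram.1 hh)).exists

theorem isSubregularEpi_of_isIso {X Y : C} (e : X ⟶ Y) [IsIso e] : IsSubregularEpi e :=
  IsConicalCoequalizer.isSubregularEpi (f := 𝟙 X) (g := 𝟙 X)
    { condition := rfl
      isQuotient := isQuotient_of_isIso e
      factors := fun _ h _ => ⟨inv e ≫ h, IsIso.hom_inv_id_assoc e h,
        fun k hk => by rw [← hk, IsIso.inv_hom_id_assoc]⟩ }

end Coequalizers

section EffectiveQuotients

variable {C : Type u} [Category.{v} C] [MetEnriched C]

/-- `e` dominates `h` if composing parallel morphisms with `h` brings them at least as close as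
composing them with `e`. In particular `h` identifies whatever `e` identifies. -/
def Dominates {X Y W : C} (e : X ⟶ Y) (h : X ⟶ W) : Prop :=
  ∀ ⦃V : C⦄ (x x' : V ⟶ X), edist (x ≫ h) (x' ≫ h) ≤ edist (x ≫ e) (x' ≫ e)

theorem dominates_comp {X Y Z : C} (e : X ⟶ Y) (k : Y ⟶ Z) : Dominates e (e ≫ k) :=
  fun _ x x' => by
    simpa only [Category.assoc] using edist_comp_right_le (x ≫ e) (x' ≫ e) k

theorem Dominates.trans {X Y Z W : C} {e : X ⟶ Y} {h : X ⟶ Z} {k : X ⟶ W}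
    (heh : Dominates e h) (hhk : Dominates h k) : Dominates e k :=
  fun _ x x' => (hhk x x').trans (heh x x')

theorem Dominates.precomp {X Y Z W : C} {e : X ⟶ Y} {h : X ⟶ W} (H : Dominates e h) (a : Z ⟶ X) :
    Dominates (a ≫ e) (a ≫ h) := fun _ x x' => by
  simpa only [Category.assoc] using H (x ≫ a) (x' ≫ a)

theorem IsIsometricEmbedding.dominates {X Y Z : C} {m : Y ⟶ Z} (hm : IsIsometricEmbedding m)
    (e : X ⟶ Y) : Dominates (e ≫ m) e := fun _ x x' => by
  rw [hm (x ≫ e) (x' ≫ e), Category.assoc, Category.assoc]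

/-- An effective quotient: a quotient through which all morphisms that it dominates factorize. In
the presence of kernel diagrams these are the subregular epimorphisms. -/
structure IsEffectiveQuotient {X Y : C} (e : X ⟶ Y) : Prop where
  isQuotient : IsQuotient e
  exists_desc : ∀ ⦃W : C⦄ (h : X ⟶ W), Dominates e h → ∃ k : Y ⟶ W, e ≫ k = h

theorem IsSubregularEpi.isEffectiveQuotient {X Y : C} {e : X ⟶ Y} (he : IsSubregularEpi e) :
    IsEffectiveQuotient e := by
  obtain ⟨D, rfl, hD⟩ := he
  rw [eqToHom_refl, Category.id_comp, isColimitMap_iff] at hD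
  obtain ⟨hcocone, hquotient, hfactors⟩ := hD
  exact ⟨hquotient, fun W h H => hfactors h fun ε => (H _ _).trans (hcocone ε)⟩

theorem IsEffectiveQuotient.of_comp {X Y Z : C} {a : X ⟶ Y} {e : Y ⟶ Z} [Epi a]
    (h : IsEffectiveQuotient (a ≫ e)) : IsEffectiveQuotient e where
  isQuotient := h.isQuotient.of_comp
  exists_desc W k hk := by
    obtain ⟨l, hl⟩ := h.exists_desc (a ≫ k) (hk.precomp a)
    exact ⟨l, (cancel_epi a).1 (by rw [← hl, Category.assoc])⟩

theorem IsEffectiveQuotient.exists_diagonal {I : Type*} {X Y P : C} {Z : I → C} {e : X ⟶ Y}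
    (he : IsEffectiveQuotient e) {p : ∀ i, P ⟶ Z i} (hp : IsIsometricFamily p) {a : X ⟶ P}
    {q : ∀ i, Y ⟶ Z i} (sq : ∀ i, a ≫ p i = e ≫ q i) :
    ∃ d : Y ⟶ P, e ≫ d = a ∧ ∀ i, d ≫ p i = q i := by
  have hdom : Dominates e a := fun V x x' => by
    rw [hp]
    refine iSup_le fun i => ?_
    simpa only [Category.assoc, sq] using dominates_comp e (q i) x x'
  obtain ⟨d, rfl⟩ := he.exists_desc a hdom
  have := he.isQuotient.epi
  exact ⟨d, rfl, fun i => (cancel_epi e).1 (by rw [← sq, Category.assoc])⟩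

end EffectiveQuotients

section KernelDiagrams

variable {C : Type u} [Category.{v} C] [MetEnriched C]

theorem IsKernelDiagram.isBasicCocone_iff {D : BasicShape ⥤ C} {Y W : C} {f : D.obj .a ⟶ Y}
    (hD : IsKernelDiagram D f) {h : D.obj .a ⟶ W} : IsBasicCocone D h ↔ Dominates f h := by
  refine ⟨fun hh V x x' => ?_, fun H ε => (H _ _).trans (hD ε).edist_le⟩
  by_cases htop : edist (x ≫ f) (x' ≫ f) = ⊤
  · exact htop ▸ le_top
  · lift edist (x ≫ f) (x' ≫ f) to ℝ≥0 using htop with δ hδ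
    obtain ⟨t, rfl, rfl⟩ := (hD δ).factors x x' hδ.ge
    rw [Category.assoc, Category.assoc]
    exact (edist_comp_left_le t _ _).trans (hh δ)

theorem IsKernelDiagram.isColimitMap_iff {D : BasicShape ⥤ C} {Y Z : C} {f : D.obj .a ⟶ Y}
    (hD : IsKernelDiagram D f) {e : D.obj .a ⟶ Z} : IsColimitMap D e ↔ Dominates f e ∧
      IsQuotient e ∧ ∀ ⦃W : C⦄ (h : D.obj .a ⟶ W), Dominates f h → ∃ k : Z ⟶ W, e ≫ k = h := by
  simp only [MetEnr.isColimitMap_iff, hD.isBasicCocone_iff]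

theorem IsKernelDiagram.isColimitMap {D : BasicShape ⥤ C} {Y Z : C} {e : D.obj .a ⟶ Z}
    {m : Z ⟶ Y} (hD : IsKernelDiagram D (e ≫ m)) (he : IsEffectiveQuotient e)
    (hm : IsIsometricEmbedding m) : IsColimitMap D e :=
  hD.isColimitMap_iff.2 ⟨hm.dominates e, he.isQuotient,
    fun _ h hh => he.exists_desc h ((dominates_comp e m).trans hh)⟩

theorem IsEffectiveQuotient.isSubregularEpi {D : BasicShape ⥤ C} {Y : C} {e : D.obj .a ⟶ Y}
    (he : IsEffectiveQuotient e) (hD : IsKernelDiagram D e) : IsSubregularEpi e :=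
  (hD.isColimitMap_iff.2 ⟨fun _ _ _ => le_rfl, he.isQuotient, he.exists_desc⟩).isSubregularEpi

theorem exists_isKernelDiagram_of_isEpsKernelPair {X Y : C} {f : X ⟶ Y} {P : ℝ≥0 → C}
    {p p' : ∀ ε, P ε ⟶ X} (hP : ∀ ε, IsEpsKernelPair ε f (p ε) (p' ε)) :
    ∃ (D : BasicShape ⥤ C) (h : D.obj .a = X), IsKernelDiagram D (eqToHom h ≫ f) := by
  have hstep {ε ε' : ℝ≥0} (h : ε ⟶ ε') : ∃ t : P ε ⟶ P ε', t ≫ p ε' = p ε ∧ t ≫ p' ε' = p' ε :=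
    (hP ε').factors _ _ ((hP ε).edist_le.trans (ENNReal.coe_le_coe.2 (leOfHom h)))
  choose t ht ht' using @hstep
  let F : ℝ≥0 ⥤ C :=
    { obj := P
      map := t
      map_id := fun ε => (hP ε).isometric.hom_ext
        (by rw [ht, Category.id_comp]) (by rw [ht', Category.id_comp])
      map_comp := fun _ _ => (hP _).isometric.hom_ext
        (by simp only [Category.assoc, ht]) (by simp only [Category.assoc, ht']) }
  let leg : Side → (F ⟶ (Functor.const ℝ≥0).obj X)
    | .l => { app := p, naturality := fun _ _ h => (ht h).trans (Category.comp_id _).symm }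
    | .r => { app := p', naturality := fun _ _ h => (ht' h).trans (Category.comp_id _).symm }
  exact ⟨basicDiagram F leg, rfl, fun ε =>
    (congrArg (IsEpsKernelPair ε · (p ε) (p' ε)) (Category.id_comp f)).mpr (hP ε)⟩

end KernelDiagrams

section Tensors

variable {C : Type u} [Category.{v} C] [MetEnriched C] {G : C}

namespace HasTensors

variable (hT : HasTensors G)

/-- The tensor `M ⊗ G`. -/
noncomputable def obj (M : Type v) [EMetricSpace M] : C := (hT ⟨M⟩).choose

/-- The unit `M ⟶ C(G, M ⊗ G)` of the tensor `M ⊗ G`, as a morphism of `Met`. -/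
noncomputable def unitHom (M : Type v) [EMetricSpace M] :
    (⟨M⟩ : Met.{v}) ⟶ homSpace G (hT.obj M) :=
  (hT ⟨M⟩).choose_spec.choose

theorem isTensor (M : Type v) [EMetricSpace M] : IsTensor ⟨M⟩ G (hT.obj M) (hT.unitHom M) :=
  (hT ⟨M⟩).choose_spec.choose_spec

variable {M N : Type v} [EMetricSpace M] [EMetricSpace N] {X Y : C}

/-- The unit `M ⟶ C(G, M ⊗ G)` of the tensor `M ⊗ G`, as a map. -/
noncomputable def unit (x : M) : G ⟶ hT.obj M := Met.fn (hT.unitHom M) x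

theorem edist_unit_le (x y : M) : edist (hT.unit x) (hT.unit y) ≤ edist x y :=
  (hT.unitHom M).nonexpanding x y

theorem edist_hom (h h' : hT.obj M ⟶ X) :
    edist h h' = ⨆ x : M, edist (hT.unit x ≫ h) (hT.unit x ≫ h') :=
  (hT.isTensor M).isometry X h h'

theorem hom_ext {h h' : hT.obj M ⟶ X} (H : ∀ x : M, hT.unit x ≫ h = hT.unit x ≫ h') : h = h' :=
  eq_of_edist_eq_zero (by simp only [hT.edist_hom, H, edist_self, ENNReal.iSup_zero])

theorem exists_desc {φ : M → (G ⟶ X)} (hφ : ∀ x y, edist (φ x) (φ y) ≤ edist x y) :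
    ∃ h : hT.obj M ⟶ X, ∀ x, hT.unit x ≫ h = φ x := by
  obtain ⟨h, hh⟩ := ((hT.isTensor M).bijective X).surjective
    (Met.Hom.mk (M := ⟨M⟩) (N := homSpace G X) φ hφ)
  exact ⟨h, fun x => congrArg (fun k : (⟨M⟩ : Met.{v}) ⟶ homSpace G X => Met.fn k x) hh⟩

/-- The morphism `M ⊗ G ⟶ X` that corresponds to a nonexpanding map `M → C(G, X)`. -/
noncomputable def desc (φ : M → (G ⟶ X)) (hφ : ∀ x y, edist (φ x) (φ y) ≤ edist x y) :
    hT.obj M ⟶ X :=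
  (hT.exists_desc hφ).choose

theorem unit_desc (φ : M → (G ⟶ X)) (hφ : ∀ x y, edist (φ x) (φ y) ≤ edist x y) (x : M) :
    hT.unit x ≫ hT.desc φ hφ = φ x :=
  (hT.exists_desc hφ).choose_spec x

theorem unit_desc_assoc (φ : M → (G ⟶ X)) (hφ : ∀ x y, edist (φ x) (φ y) ≤ edist x y) (x : M)
    (k : X ⟶ Y) : hT.unit x ≫ hT.desc φ hφ ≫ k = φ x ≫ k := by
  rw [← Category.assoc, unit_desc]

/-- The morphism `M ⊗ G ⟶ N ⊗ G` induced by a nonexpanding map `M → N`. -/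
noncomputable def map (f : M → N) (hf : ∀ x y, edist (f x) (f y) ≤ edist x y) :
    hT.obj M ⟶ hT.obj N :=
  hT.desc (fun x => hT.unit (f x)) fun x y =>
    (hT.edist_unit_le (f x) (f y)).trans (hf x y)

theorem unit_map (f : M → N) (hf : ∀ x y, edist (f x) (f y) ≤ edist x y) (x : M) :
    hT.unit x ≫ hT.map f hf = hT.unit (f x) :=
  hT.unit_desc _ _ x

theorem unit_map_assoc (f : M → N) (hf : ∀ x y, edist (f x) (f y) ≤ edist x y) (x : M)
    (k : hT.obj N ⟶ Y) : hT.unit x ≫ hT.map f hf ≫ k = hT.unit (f x) ≫ k :=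
  hT.unit_desc_assoc _ _ x k

variable (X) in
/-- The evaluation morphism `C(G, X) ⊗ G ⟶ X`. -/
noncomputable def ev : hT.obj (G ⟶ X) ⟶ X := hT.desc (fun g => g) fun _ _ => le_rfl

theorem unit_ev (g : G ⟶ X) : hT.unit g ≫ hT.ev X = g := hT.unit_desc _ _ g

theorem unit_ev_assoc (g : G ⟶ X) (k : X ⟶ Y) : hT.unit g ≫ hT.ev X ≫ k = g ≫ k :=
  hT.unit_desc_assoc _ _ g k

theorem isReflexivePair_ev_map {α : (G ⟶ hT.obj M) → M}
    (hα : ∀ s t, edist (α s) (α t) ≤ edist s t) (hα_unit : ∀ x, α (hT.unit x) = x) :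
    IsReflexivePair (hT.ev (hT.obj M)) (hT.map α hα) := by
  refine ⟨hT.map hT.unit hT.edist_unit_le, hT.hom_ext fun x => ?_,
    hT.hom_ext fun x => ?_⟩
  · rw [unit_map_assoc, unit_ev, Category.comp_id]
  · rw [unit_map_assoc, unit_map, hα_unit, Category.comp_id]

theorem isEffectiveQuotient_map {f : M → N} (hf : ∀ x y, edist (f x) (f y) ≤ edist x y)
    (hsurj : Function.Surjective f) : IsEffectiveQuotient (hT.map f hf) where
  isQuotient := isQuotient_of_le fun U k k' => by
    rw [hT.edist_hom]
    refine iSup_le fun y => ?_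
    obtain ⟨x, rfl⟩ := hsurj y
    rw [← hT.unit_map_assoc f hf, ← hT.unit_map_assoc f hf]
    exact edist_comp_left_le _ _ _
  exists_desc W h H := by
    have hle (x x' : M) : edist (hT.unit x ≫ h) (hT.unit x' ≫ h) ≤ edist (f x) (f x') :=
      (H _ _).trans <| by
        rw [unit_map, unit_map]
        exact hT.edist_unit_le (f x) (f x')
    let σ := Function.surjInv hsurj
    have hσ (y : N) : f (σ y) = y := Function.surjInv_eq hsurj y
    refine ⟨hT.desc (fun y => hT.unit (σ y) ≫ h) fun y y' => ?_, hT.hom_ext fun x => ?_⟩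
    · simpa only [hσ] using hle (σ y) (σ y')
    · rw [unit_map_assoc, unit_desc]
      exact edist_le_zero.1 ((hle _ _).trans_eq (by rw [hσ, edist_self]))

end HasTensors

end Tensors

section Generators

variable {C : Type u} [Category.{v} C] [MetEnriched C] {G : C}

namespace IsSubregularGenerator

variable {X Y Z : C}

theorem isSubregularEpi_ev (hG : IsSubregularGenerator G) (X : C) :
    IsSubregularEpi (hG.hasTensors.ev X) :=
  hG.evaluation _ (hG.hasTensors.isTensor (G ⟶ X)) _
    (Met.Hom.ext (funext fun g => hG.hasTensors.unit_ev g))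

theorem edist_eq_iSup (hG : IsSubregularGenerator G) (u u' : X ⟶ Y) :
    edist u u' = ⨆ g : G ⟶ X, edist (g ≫ u) (g ≫ u') := by
  rw [(hG.isSubregularEpi_ev X).isEffectiveQuotient.isQuotient, hG.hasTensors.edist_hom]
  simp only [HasTensors.unit_ev_assoc]

theorem dominates_iff (hG : IsSubregularGenerator G) {e : X ⟶ Y} {h : X ⟶ Z} :
    Dominates e h ↔ ∀ x x' : G ⟶ X, edist (x ≫ h) (x' ≫ h) ≤ edist (x ≫ e) (x' ≫ e) := by
  refine ⟨fun H => H (V := G), fun H V x x' => ?_⟩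
  simp only [hG.edist_eq_iSup (X := V)]
  exact iSup_mono fun g => by simpa only [Category.assoc] using H (g ≫ x) (g ≫ x')

theorem isIsometricFamily (hG : IsSubregularGenerator G) {I : Type*} {P : C} {X : I → C}
    {p : ∀ i, P ⟶ X i} (H : ∀ g g' : G ⟶ P, edist g g' ≤ ⨆ i, edist (g ≫ p i) (g' ≫ p i)) :
    IsIsometricFamily p := fun V u u' => by
  refine le_antisymm ?_ (iSup_le fun i => edist_comp_right_le u u' (p i))
  rw [hG.edist_eq_iSup]
  refine iSup_le fun g => (H _ _).trans (iSup_mono fun i => ?_)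
  simpa only [Category.assoc] using edist_comp_left_le g (u ≫ p i) (u' ≫ p i)

theorem isIsometricEmbedding (hG : IsSubregularGenerator G) {m : X ⟶ Y}
    (H : ∀ g g' : G ⟶ X, edist g g' ≤ edist (g ≫ m) (g' ≫ m)) : IsIsometricEmbedding m :=
  (isIsometricFamily_of_unique fun _ : Unit => m).1
    (hG.isIsometricFamily fun g g' => by simpa only [iSup_unique] using H g g')

theorem isEffectiveQuotient_comp (hG : IsSubregularGenerator G) {b : X ⟶ Y} {c : Y ⟶ Z}
    (hb : IsEffectiveQuotient b) (hlift : ∀ y : G ⟶ Y, ∃ x : G ⟶ X, x ≫ b = y)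
    (hc : IsEffectiveQuotient c) : IsEffectiveQuotient (b ≫ c) where
  isQuotient := hb.isQuotient.comp hc.isQuotient
  exists_desc W h H := by
    obtain ⟨k, rfl⟩ := hb.exists_desc h ((dominates_comp b c).trans H)
    have hck : Dominates c k := hG.dominates_iff.2 fun y y' => by
      obtain ⟨x, rfl⟩ := hlift y
      obtain ⟨x', rfl⟩ := hlift y'
      simpa only [Category.assoc] using H x x'
    obtain ⟨l, rfl⟩ := hc.exists_desc k hck
    exact ⟨l, Category.assoc b c l⟩

theorem exists_lift (hG : IsSubregularGenerator G) {I : Type*} {P V : C} {X : I → C}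
    {p : ∀ i, P ⟶ X i} (hp : IsIsometricFamily p) {q : ∀ i, V ⟶ X i}
    (hq : ∀ g : G ⟶ V, ∃ x : G ⟶ P, ∀ i, x ≫ p i = g ≫ q i) :
    ∃ t : V ⟶ P, ∀ i, t ≫ p i = q i := by
  choose φ hφ using hq
  have hφ_le (g g' : G ⟶ V) : edist (φ g) (φ g') ≤ edist g g' := by
    rw [hp]
    refine iSup_le fun i => ?_
    rw [hφ, hφ]
    exact edist_comp_right_le g g' (q i)
  have hsq (i : I) : hG.hasTensors.desc φ hφ_le ≫ p i = hG.hasTensors.ev V ≫ q i :=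
    hG.hasTensors.hom_ext fun g => by
      rw [HasTensors.unit_desc_assoc, HasTensors.unit_ev_assoc, hφ]
  obtain ⟨t, -, ht⟩ := (hG.isSubregularEpi_ev V).isEffectiveQuotient.exists_diagonal hp hsq
  exact ⟨t, ht⟩

end IsSubregularGenerator

end Generators

section Realization

variable {C : Type u} [Category.{v} C] [MetEnriched C] {G : C}

-- The hypotheses make `M` a subalgebra of `∏ C(G, X i)`: a subspace closed under every operation
-- `t : G ⟶ M ⊗ G`. The object `Q` is the algebra `M`, presented by the free algebra `M ⊗ G` modulo
-- the equations `t = α t` that hold in `M`.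
theorem exists_isIsometricFamily_of_closed (hC : HasReflexiveConicalCoequalizers C)
    (hG : IsSubregularGenerator G) (hP : IsSubregularProjective G) {M : Type v} [EMetricSpace M]
    {I : Type*} {X : I → C} (q : ∀ i, hG.hasTensors.obj M ⟶ X i)
    (hdist : ∀ x y : M, edist x y ≤
      ⨆ i, edist (hG.hasTensors.unit x ≫ q i) (hG.hasTensors.unit y ≫ q i))
    (hclosed : ∀ t : G ⟶ hG.hasTensors.obj M, ∃ x : M,
      ∀ i, t ≫ q i = hG.hasTensors.unit x ≫ q i) :
    ∃ (Q : C) (c : hG.hasTensors.obj M ⟶ Q) (p : ∀ i, Q ⟶ X i),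
      IsSubregularEpi c ∧ IsIsometricFamily p ∧ ∀ i, c ≫ p i = q i := by
  have hT := hG.hasTensors
  choose α hα using hclosed
  have hα_le (s t) : edist (α s) (α t) ≤ edist s t := (hdist _ _).trans <| iSup_le fun i => by
    rw [← hα, ← hα]
    exact edist_comp_right_le s t (q i)
  have hα_unit (x : M) : α (hT.unit x) = x := edist_le_zero.1 <| (hdist _ _).trans <|
    iSup_le fun i => by rw [← hα, edist_self]
  obtain ⟨Q, c, hc⟩ := hC _ _ (hT.isReflexivePair_ev_map hα_le hα_unit)
  have hcα (t : G ⟶ hT.obj M) : t ≫ c = hT.unit (α t) ≫ c := by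
    simpa only [HasTensors.unit_ev_assoc, HasTensors.unit_map_assoc] using
      congrArg (hT.unit t ≫ ·) hc.condition
  have hdesc (i : I) : ∃ p : Q ⟶ X i, c ≫ p = q i :=
    (hc.factors (q i) (hT.hom_ext fun t => by
      rw [HasTensors.unit_ev_assoc, HasTensors.unit_map_assoc, hα])).exists
  choose p hp using hdesc
  have hpoint (g : G ⟶ Q) : ∃ x : M, hT.unit x ≫ c = g := by
    obtain ⟨t, rfl⟩ := hP c hc.isSubregularEpi g
    exact ⟨α t, (hcα t).symm⟩
  refine ⟨Q, c, p, hc.isSubregularEpi, hG.isIsometricFamily fun g g' => ?_, hp⟩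
  obtain ⟨x, rfl⟩ := hpoint g
  obtain ⟨y, rfl⟩ := hpoint g'
  simp only [Category.assoc, hp]
  exact ((edist_comp_right_le _ _ c).trans (hT.edist_unit_le x y)).trans (hdist x y)

theorem exists_isEpsKernelPair (hC : HasReflexiveConicalCoequalizers C)
    (hG : IsSubregularGenerator G) (hP : IsSubregularProjective G) {X Y : C} (f : X ⟶ Y)
    (ε : ℝ≥0) : ∃ (P : C) (p p' : P ⟶ X), IsEpsKernelPair ε f p p' := by
  have hT := hG.hasTensors
  let M := {x : (G ⟶ X) × (G ⟶ X) // edist (x.1 ≫ f) (x.2 ≫ f) ≤ ε}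
  let proj (s : Side) (x : M) : G ⟶ X := s.rec x.1.1 x.1.2
  have hproj (s : Side) (x y : M) : edist (proj s x) (proj s y) ≤ edist x y := by
    cases s
    exacts [le_max_left _ _, le_max_right _ _]
  let q (s : Side) : hT.obj M ⟶ X := hT.desc (proj s) (hproj s)
  have hq : edist (q .l ≫ f) (q .r ≫ f) ≤ ε := by
    rw [hT.edist_hom]
    refine iSup_le fun x => ?_
    rw [HasTensors.unit_desc_assoc, HasTensors.unit_desc_assoc]
    exact x.2
  have pair_mem {V : C} {r : Side → (V ⟶ X)} (hr : edist (r .l ≫ f) (r .r ≫ f) ≤ ε) (g : G ⟶ V) :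
      ∃ x : M, ∀ s, hT.unit x ≫ q s = g ≫ r s := by
    refine ⟨⟨(g ≫ r .l, g ≫ r .r), ?_⟩, fun s => (hT.unit_desc _ _ _).trans (by cases s <;> rfl)⟩
    simp only [Category.assoc]
    exact (edist_comp_left_le g _ _).trans hr
  obtain ⟨P, c, p, hc, hp, hcp⟩ := exists_isIsometricFamily_of_closed hC hG hP q
    (fun x y => by simp only [iSup_side, q, HasTensors.unit_desc]; exact le_rfl)
    (fun t => (pair_mem hq t).imp fun x hx s => (hx s).symm)
  refine ⟨P, p .l, p .r, (isIsometricFamily_side p).1 hp, ?_, fun V r r' hr => ?_⟩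
  · rw [hc.isEffectiveQuotient.isQuotient]
    simpa only [← Category.assoc, hcp] using hq
  · let r (s : Side) : V ⟶ X := s.rec r r'
    obtain ⟨t, ht⟩ := hG.exists_lift (q := r) hp fun g =>
      (pair_mem (r := r) hr g).elim fun x hx => ⟨hT.unit x ≫ c, fun s => by
        rw [Category.assoc, hcp, hx]⟩
    exact ⟨t, ht .l, ht .r⟩

theorem exists_isKernelDiagram (hC : HasReflexiveConicalCoequalizers C)
    (hG : IsSubregularGenerator G) (hP : IsSubregularProjective G) {X Y : C} (f : X ⟶ Y) :
    ∃ (D : BasicShape ⥤ C) (h : D.obj .a = X), IsKernelDiagram D (eqToHom h ≫ f) := by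
  choose P p p' hp using exists_isEpsKernelPair hC hG hP f
  exact exists_isKernelDiagram_of_isEpsKernelPair hp

theorem isSubregularEpi_iff_isEffectiveQuotient (hC : HasReflexiveConicalCoequalizers C)
    (hG : IsSubregularGenerator G) (hP : IsSubregularProjective G) {X Y : C} {e : X ⟶ Y} :
    IsSubregularEpi e ↔ IsEffectiveQuotient e := by
  refine ⟨IsSubregularEpi.isEffectiveQuotient, fun he => ?_⟩
  obtain ⟨D, rfl, hD⟩ := exists_isKernelDiagram hC hG hP e
  rw [eqToHom_refl, Category.id_comp] at hD
  exact he.isSubregularEpi hD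

end Realization

section Factorization

variable {C : Type u} [Category.{v} C] [MetEnriched C] {G : C}

theorem exists_factorization (hC : HasReflexiveConicalCoequalizers C)
    (hG : IsSubregularGenerator G) (hP : IsSubregularProjective G) {X Y : C} (f : X ⟶ Y) :
    ∃ (Z : C) (e : X ⟶ Z) (m : Z ⟶ Y),
      IsSubregularEpi e ∧ IsIsometricEmbedding m ∧ e ≫ m = f := by
  have hT := hG.hasTensors
  let M := Set.range fun x : G ⟶ X => x ≫ f
  let φ : (G ⟶ X) → M := Set.rangeFactorization fun x => x ≫ f
  have hφ (x x') : edist (φ x) (φ x') ≤ edist x x' := edist_comp_right_le x x' f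
  have hmap := hT.isEffectiveQuotient_map hφ Set.rangeFactorization_surjective
  have hmap_lift (t : G ⟶ hT.obj M) : ∃ s, s ≫ hT.map φ hφ = t :=
    hP _ ((isSubregularEpi_iff_isEffectiveQuotient hC hG hP).2 hmap) t
  let q : hT.obj M ⟶ Y := hT.desc Subtype.val fun _ _ => le_rfl
  have hmap_q : hT.map φ hφ ≫ q = hT.ev X ≫ f := hT.hom_ext fun x => by
    rw [HasTensors.unit_map_assoc, HasTensors.unit_desc, HasTensors.unit_ev_assoc]
    rfl
  obtain ⟨Z, c, m, hc, hm, hcm⟩ := exists_isIsometricFamily_of_closed hC hG hP (fun _ : Unit => q)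
    (fun y y' => by simp only [iSup_unique, q, HasTensors.unit_desc]; exact le_rfl)
    (fun t => by
      obtain ⟨s, rfl⟩ := hmap_lift t
      refine ⟨φ (s ≫ hT.ev X), fun _ => ?_⟩
      rw [Category.assoc, hmap_q, HasTensors.unit_desc, ← Category.assoc]
      rfl)
  have hev := (hG.isSubregularEpi_ev X).isEffectiveQuotient
  have := hev.isQuotient.epi
  obtain ⟨e, he, hem⟩ := hev.exists_diagonal hm (a := hT.map φ hφ ≫ c) (q := fun _ => f)
    fun i => by rw [Category.assoc, hcm, hmap_q]
  have heff : IsEffectiveQuotient (hT.ev X ≫ e) :=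
    he ▸ hG.isEffectiveQuotient_comp hmap hmap_lift hc.isEffectiveQuotient
  exact ⟨Z, e, m (), (isSubregularEpi_iff_isEffectiveQuotient hC hG hP).2 heff.of_comp,
    (isIsometricFamily_of_unique m).1 hm, hem ()⟩

theorem isFactorizationSystem (hC : HasReflexiveConicalCoequalizers C)
    (hG : IsSubregularGenerator G) (hP : IsSubregularProjective G) :
    IsFactorizationSystem (subregularEpis C) (isometricEmbeddings C) where
  iso_left _ _ e (_ : IsIso e) := isSubregularEpi_of_isIso e
  iso_right _ _ m (_ : IsIso m) := isIsometricEmbedding_of_isIso m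
  comp_left _ _ _ e e' he he' := (isSubregularEpi_iff_isEffectiveQuotient hC hG hP).2 <|
    hG.isEffectiveQuotient_comp he.isEffectiveQuotient (hP e he) he'.isEffectiveQuotient
  comp_right _ _ _ _ _ hm hm' := hm.comp hm'
  factorization _ _ f := exists_factorization hC hG hP f
  diagonal _ _ _ _ e m p q he hm sq := by
    have := he.isEffectiveQuotient.isQuotient.epi
    obtain ⟨d, hd, hdm⟩ := he.isEffectiveQuotient.exists_diagonal
      ((isIsometricFamily_of_unique fun _ : Unit => m).2 hm) (q := fun _ => q) fun _ => sq
    exact ⟨d, ⟨hd, hdm ()⟩, fun d' hd' => (cancel_epi e).1 (hd'.1.trans hd.symm)⟩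

theorem IsKernelDiagram.exists_isColimitMap (hC : HasReflexiveConicalCoequalizers C)
    (hG : IsSubregularGenerator G) (hP : IsSubregularProjective G) {D : BasicShape ⥤ C} {Y : C}
    {f : D.obj .a ⟶ Y} (hD : IsKernelDiagram D f) :
    ∃ (Z : C) (e : D.obj .a ⟶ Z), IsColimitMap D e := by
  obtain ⟨Z, e, m, he, hm, rfl⟩ := exists_factorization hC hG hP f
  exact ⟨Z, e, hD.isColimitMap he.isEffectiveQuotient hm⟩

theorem IsKernelDiagram.existsUnique_comp_eq {D : BasicShape ⥤ C} {Y Z : C} {f : D.obj .a ⟶ Y}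
    (hD : IsKernelDiagram D f) {e : D.obj .a ⟶ Z} (he : IsColimitMap D e) :
    ∃! m : Z ⟶ Y, e ≫ m = f := by
  obtain ⟨-, hquotient, hdesc⟩ := hD.isColimitMap_iff.1 he
  obtain ⟨m, hm⟩ := hdesc f fun _ _ _ => le_rfl
  have := hquotient.epi
  exact ⟨m, hm, fun m' hm' => (cancel_epi e).1 (hm'.trans hm.symm)⟩

theorem IsKernelDiagram.isIsometricEmbedding (hG : IsSubregularGenerator G)
    (hP : IsSubregularProjective G) {D : BasicShape ⥤ C} {Y Z : C} {e : D.obj .a ⟶ Z}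
    {m : Z ⟶ Y} (hD : IsKernelDiagram D (e ≫ m)) (he : IsColimitMap D e) :
    IsIsometricEmbedding m := by
  refine hG.isIsometricEmbedding fun g g' => ?_
  obtain ⟨x, rfl⟩ := hP e he.isSubregularEpi g
  obtain ⟨x', rfl⟩ := hP e he.isSubregularEpi g'
  simpa only [Category.assoc] using (hD.isColimitMap_iff.1 he).1 x x'

end Factorization

end MetEnr

theorem propositionP_general {C : Type u} [Category.{v} C] [MetEnriched C]
    (hC : HasReflexiveConicalCoequalizers C) (G : C) (hG : IsSubregularGenerator G)
    (hP : IsSubregularProjective G) :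
    IsFactorizationSystem (subregularEpis C) (isometricEmbeddings C) ∧
    (∀ (X Y : C) (f : X ⟶ Y), ∃ (D : BasicShape ⥤ C) (h : D.obj .a = X),
      IsKernelDiagram D (eqToHom h ≫ f)) ∧
    (∀ (D : BasicShape ⥤ C) (Y : C) (f : D.obj .a ⟶ Y), IsKernelDiagram D f →
      (∃ (Z : C) (e : D.obj .a ⟶ Z), IsColimitMap D e) ∧
      ∀ (Z : C) (e : D.obj .a ⟶ Z), IsColimitMap D e →
        IsSubregularEpi e ∧ (∃! m : Z ⟶ Y, e ≫ m = f) ∧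
          ∀ m : Z ⟶ Y, e ≫ m = f → IsIsometricEmbedding m) := by
  refine ⟨isFactorizationSystem hC hG hP, fun X Y f => exists_isKernelDiagram hC hG hP f,
    fun D Y f hD => ⟨hD.exists_isColimitMap hC hG hP, fun Z e he =>
      ⟨he.isSubregularEpi, hD.existsUnique_comp_eq he, ?_⟩⟩⟩
  rintro m rfl
  exact hD.isIsometricEmbedding hG hP he

theorem propositionP {C : Type u} [Category.{v} C] [MetEnriched C]
    (hC : HasReflexiveConicalCoequalizers C) (G : C) (hG : IsSubvarietalGenerator G) :
    IsFactorizationSystem (subregularEpis C) (isometricEmbeddings C) ∧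
    -- every morphism has a kernel diagram
    (∀ (X Y : C) (f : X ⟶ Y), ∃ (D : BasicShape ⥤ C) (h : D.obj .a = X),
      IsKernelDiagram D (eqToHom h ≫ f)) ∧
    -- the colimit of the kernel diagram exists, and yields the factorization
    (∀ (D : BasicShape ⥤ C) (Y : C) (f : D.obj .a ⟶ Y), IsKernelDiagram D f →
      (∃ (Z : C) (e : D.obj .a ⟶ Z), IsColimitMap D e) ∧
      ∀ (Z : C) (e : D.obj .a ⟶ Z), IsColimitMap D e →
        IsSubregularEpi e ∧ (∃! m : Z ⟶ Y, e ≫ m = f) ∧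
          ∀ m : Z ⟶ Y, e ≫ m = f → IsIsometricEmbedding m) :=
  propositionP_general hC G hG.toIsSubregularGenerator hG.projective
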